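/- A \emph{chain-complete poset} (cpo) is a partially ordered set in which every chain, including the empty one, has a join. Let $\mathbf{CPO}$ be the category of cpo's and of maps preserving joins of chains, and let $3$ be the three-element chain $0<1<2$. Let $\mathcal K$ be a category. A set $\mathcal G$ of objects of $\mathcal K$ is a \emph{strong generator} if (i) for any two distinct morphisms $f,g\colon A\to B$ there is $h\colon G\to A$ with $G\in\mathcal G$ and $fh\neq gh$, and (ii) for every object $B$ and every proper subobject of $B$ there is a morphism $G\to B$ with $G\in\mathcal G$ that does not factor through that subobject. $\mathcal K$ is \emph{weakly co-wellpowered} if each of its objects has, up to isomorphism, only a set of strong quotients. Suppose that $\mathcal K$ is cocomplete and let $\lambda$ be a regular cardinal. Every coproduct $\coprod_{i\in I}K_i$ is the $\lambda$-directed colimit of its subcoproducts $\coprod_{j\in J}K_j$, where $J\subseteq I$ and $|J|<\lambda$; an object $A$ is \emph{nearly $\lambda$-presentable} if $\mathcal K(A,-)\colon\mathcal K\to\mathbf{Set}$ preserves all these $\lambda$-directed colimits. A category is \emph{nearly locally $\lambda$-presentable} if it is cocomplete and weakly co-wellpowered and has a strong generator that is a set of nearly $\lambda$-presentable objects. Then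 $\mathbf{CPO}$ is nearly locally $\aleph_0$-presentable. Moreover, $\mathbf{CPO}$ is cocomplete and weakly co-wellpowered, the chain $3$ is a nearly $\aleph_0$-presentable object of $\mathbf{CPO}$, and $\{3\}$ is a strong generator in $\mathbf{CPO}$. -/

import Mathlib

open CategoryTheory CategoryTheory.Limits Opposite
open scoped Cardinal

universe w v u

/-- A chain-complete poset (cpo): a partially ordered set in which every chain has a join.
The empty chain is allowed, so that a cpo has a least element. -/
structure CPO : Type (u + 1) where
  carrier : Type u
  [order : PartialOrder carrier]
  exists_isLUB : ∀ s : Set carrier, IsChain (· ≤ ·) s → ∃ x, IsLUB s x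

namespace CPO

attribute [instance] CPO.order

/-- A cpo map: a map that preserves the joins of all chains, including the empty one. -/
@[ext]
structure Hom (A B : CPO.{u}) where
  toFun : A.carrier → B.carrier
  map_isLUB : ∀ (s : Set A.carrier) (x : A.carrier),
    IsChain (· ≤ ·) s → IsLUB s x → IsLUB (toFun '' s) (toFun x)

theorem Hom.monotone {A B : CPO.{u}} (f : Hom A B) : Monotone f.toFun := by
  intro a b hab
  have hc : IsChain (· ≤ ·) ({a, b} : Set A.carrier) := IsChain.pair hab
  have hb : IsLUB ({a, b} : Set A.carrier) b := by
    refine ⟨?_, fun c hcb => hcb (by simp)⟩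
    rintro x (rfl | rfl)
    · exact hab
    · exact le_rfl
  exact (f.map_isLUB _ _ hc hb).1 ⟨a, by simp, rfl⟩

instance : LargeCategory.{u} CPO.{u} where
  Hom A B := Hom A B
  id A := ⟨id, fun s x _ hx => by simpa using hx⟩
  comp f g := ⟨g.toFun ∘ f.toFun, fun s x hs hx => by
    rw [Set.image_comp]
    exact g.map_isLUB _ _ (hs.image_of_map_rel _ _ f.toFun (fun _ _ h => f.monotone h))
      (f.map_isLUB _ _ hs hx)⟩

/-- The three-element chain `0 < 1 < 2`, as a cpo. -/
def chain3 : CPO.{u} where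
  carrier := ULift.{u} (Fin 3)
  exists_isLUB s _ := by
    classical
    obtain ⟨x, hx⟩ : ∃ x : Fin 3, IsLUB (ULift.down '' s) x := ⟨_, isLUB_sSup _⟩
    refine ⟨⟨x⟩, fun a ha => hx.1 ⟨a, ha, rfl⟩, fun b hb => hx.2 ?_⟩
    rintro _ ⟨a, ha, rfl⟩
    exact hb ha

end CPO

namespace NearlyPresentable

section Definitions

variable {C : Type u} [Category.{v} C]

section Subcoproducts

variable [HasCoproducts.{w} C] (κ : Cardinal.{w}) {ι : Type w} (X : ι → C)

/-- The diagram of all subcoproducts `∐_{j ∈ J} X j`, where `J` runs over the subsets of `ι` with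
fewer than `κ` elements, ordered by inclusion. -/
noncomputable def subcoproducts : {J : Set ι // HasCardinalLT J κ} ⥤ C where
  obj J := ∐ fun j : J.1 => X j
  map {_ K} h := Sigma.desc fun j => Sigma.ι (fun k : K.1 => X k) ⟨j.1, leOfHom h j.2⟩

/-- The coproduct `∐ X` as a cocone over its subcoproducts with fewer than `κ` summands. -/
noncomputable def subcoproductsCocone : Cocone (subcoproducts κ X) where
  pt := ∐ X
  ι := { app := fun J => Sigma.desc fun j : J.1 => Sigma.ι X j
         naturality := fun _ _ _ => Sigma.hom_ext _ _ fun _ => by simp [subcoproducts] }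

variable {κ X} in
/-- The coproduct injections of a subcoproduct. -/
noncomputable def subcoproductsι (J : {J : Set ι // HasCardinalLT J κ}) {i : ι} (hi : i ∈ J.1) :
    X i ⟶ (subcoproducts κ X).obj J :=
  Sigma.ι (fun j : J.1 => X j) ⟨i, hi⟩

variable {κ X} in
theorem subcoproductsι_map {J K : {J : Set ι // HasCardinalLT J κ}} (h : J ⟶ K) {i : ι}
    (hi : i ∈ J.1) :
    subcoproductsι J hi ≫ (subcoproducts κ X).map h = subcoproductsι K (leOfHom h hi) :=
  Sigma.ι_desc _ _

variable {κ X} in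
theorem subcoproductsι_app (J : {J : Set ι // HasCardinalLT J κ}) {i : ι} (hi : i ∈ J.1) :
    subcoproductsι J hi ≫ (subcoproductsCocone κ X).ι.app J = Sigma.ι X i :=
  Sigma.ι_desc _ _

variable {κ X} in
theorem subcoproducts_hom_ext {J : {J : Set ι // HasCardinalLT J κ}} {Y : C}
    {f g : (subcoproducts κ X).obj J ⟶ Y}
    (h : ∀ i (hi : i ∈ J.1), subcoproductsι J hi ≫ f = subcoproductsι J hi ≫ g) : f = g :=
  Sigma.hom_ext _ _ fun j => h j.1 j.2

/-- For regular `κ`, every coproduct is the `κ`-directed colimit of its subcoproducts with fewer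
than `κ` summands. -/
theorem nonempty_isColimit_subcoproductsCocone [hκ : Fact κ.IsRegular] :
    Nonempty (IsColimit (subcoproductsCocone κ X)) := by
  have hs (i : ι) : HasCardinalLT ({i} : Set ι) κ := by
    rw [hasCardinalLT_iff_cardinal_mk_lt, Cardinal.mk_singleton]
    exact Cardinal.one_lt_aleph0.trans_le hκ.out.aleph0_le
  have hd (s : Cocone (subcoproducts κ X)) :
      ∃ d : (subcoproductsCocone κ X).pt ⟶ s.pt, ∀ i,
        (Sigma.ι X i : X i ⟶ (subcoproductsCocone κ X).pt) ≫ d =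
          subcoproductsι ⟨{i}, hs i⟩ (Set.mem_singleton i) ≫ s.ι.app ⟨{i}, hs i⟩ :=
    ⟨Sigma.desc fun i =>
      subcoproductsι ⟨{i}, hs i⟩ (Set.mem_singleton i) ≫ s.ι.app ⟨{i}, hs i⟩,
      fun i => Sigma.ι_desc _ _⟩
  choose d hd using hd
  refine ⟨{ desc := d, fac := fun s J => ?_, uniq := fun s m hm => ?_ }⟩
  · refine subcoproducts_hom_ext fun i hi => ?_
    have h : (⟨{i}, hs i⟩ : {J : Set ι // HasCardinalLT J κ}) ≤ J :=
      Set.singleton_subset_iff.2 hi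
    rw [← Category.assoc, subcoproductsι_app]
    refine (hd s i).trans ?_
    rw [← s.w (homOfLE h), ← Category.assoc, subcoproductsι_map]
  · refine Sigma.hom_ext (f := X) _ _ fun i => ?_
    refine Eq.trans ?_ (hd s i).symm
    rw [← hm ⟨{i}, hs i⟩, ← Category.assoc, subcoproductsι_app]
    rfl

/-- An object `A` is nearly `κ`-presentable if `Hom(A, -)` preserves, for every small coproduct, the
`κ`-directed colimit that expresses it through its subcoproducts with fewer than `κ` summands. -/
def IsNearlyPresentable [Fact κ.IsRegular] (A : C) : Prop :=
  ∀ ⦃ι : Type w⦄ (X : ι → C), PreservesColimit (subcoproducts κ X) (coyoneda.obj (op A))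

end Subcoproducts

variable (C)

/-- Every object has only a set (indexed by a type in universe `w`) of strong quotients, up to
isomorphism under the object. -/
def IsWeaklyCowellpowered : Prop :=
  ∀ A : C, ∃ (S : Type w) (Q : S → C) (q : ∀ s, A ⟶ Q s), (∀ s, StrongEpi (q s)) ∧
    ∀ (B : C) (e : A ⟶ B), StrongEpi e → ∃ (s : S) (φ : Q s ≅ B), q s ≫ φ.hom = e

/-- A category is nearly locally `κ`-presentable if it is cocomplete and weakly co-wellpowered and
it has a strong generator that is a set of nearly `κ`-presentable objects. -/
class IsNearlyLocallyPresentable (κ : Cardinal.{w}) [Fact κ.IsRegular] : Prop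
    extends HasColimitsOfSize.{w, w} C where
  isWeaklyCowellpowered : IsWeaklyCowellpowered.{w} C
  exists_strongGenerator : ∃ P : ObjectProperty C, ObjectProperty.Small.{w} P ∧
    P.IsStrongGenerator ∧ ∀ G, P G → IsNearlyPresentable κ G

end Definitions

end NearlyPresentable

attribute [local instance] Cardinal.fact_isRegular_aleph0

open NearlyPresentable

/-!
A map out of the chain `3` that preserves joins of chains sends `0` to the least element, so it is
the same as a pair `a ≤ b`. Such maps therefore detect equality of morphisms, and a monomorphism
through which all of them factor is bijective and reflects the order, hence is an isomorphism
(`isStrongGenerator_singleton_chain3`).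

Cocompleteness does not need a description of coequalizers. Call a set `U` in a cpo *chain-open* if
the join of a chain lies in `U` exactly when some member of the chain does. The complement of every
principal ideal is chain-open, so chain-open sets separate points and determine the order. Given a
small diagram `F`, let `H` be the set of families of chain-open sets `U j ⊆ F j` which are
compatible under preimage. An element of `F j` determines the set of those families that contain
it, and the colimit is the smallest subset of `Set H` that is closed under unions of chains and
contains all these sets. By induction along this closure, each of its elements determines a
unique element of the point of any cocone (`exists_mem_iff_of_cocone`).

If `e : A ⟶ B` is a strong epimorphism, then `B` is the closure under joins of chains of the
image of `e`; therefore every `b : B` is the join of the elements `e a ≤ b`, and `B` embeds in the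
power set of `A` (`le_iff_of_strongEpi`). This bounds the strong quotients of `A`.

Finally, let `f : 3 ⟶ ∐ X`. Each summand is a retract of the coproduct, all other summands being
sent to the least element, and the union of the summands is closed under joins of chains, so it is
the whole coproduct (`eq_bot_or_exists_eq_ι`). Elements of different summands are comparable only
if one of them is the least element, so `f` is trivial or factors through a single summand.
Together with the fact that a subcoproduct is a retract of the coproduct, this says that `3` is
nearly `ℵ₀`-presentable.
-/

namespace CPO

variable {A B D : CPO.{u}}

/-! ### Chain-complete posets and their maps -/

/-- The least element of a cpo is the join of the empty chain. -/
noncomputable instance : OrderBot A.carrier where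
  bot := (A.exists_isLUB ∅ Set.subsingleton_empty.isChain).choose
  bot_le a := (A.exists_isLUB ∅ Set.subsingleton_empty.isChain).choose_spec.2 (by simp)

theorem Hom.map_bot (f : A ⟶ B) : f.toFun ⊥ = ⊥ := by
  have h := f.map_isLUB ∅ ⊥ Set.subsingleton_empty.isChain (isLUB_empty_iff.2 isBot_bot)
  rw [Set.image_empty] at h
  exact (isLUB_empty_iff.1 h).eq_bot

theorem Hom.isChain_image (f : A ⟶ B) {s : Set A.carrier} (hs : IsChain (· ≤ ·) s) :
    IsChain (· ≤ ·) (f.toFun '' s) :=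
  hs.image_of_map_rel _ _ f.toFun fun _ _ h => f.monotone h

theorem hom_ext {f g : A ⟶ B} (h : ∀ a, f.toFun a = g.toFun a) : f = g :=
  Hom.ext (funext h)

theorem comp_apply (f : A ⟶ B) (g : B ⟶ D) (a : A.carrier) :
    (f ≫ g).toFun a = g.toFun (f.toFun a) := rfl

theorem id_apply (a : A.carrier) : (𝟙 A : A ⟶ A).toFun a = a := rfl

variable (A B) in
/-- The map that is constantly the least element. -/
noncomputable def botHom : A ⟶ B where
  toFun _ := ⊥
  map_isLUB s x hs hx := by
    rcases s.eq_empty_or_nonempty with rfl | hne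
    · simp
    · rw [hne.image_const]
      exact isLUB_singleton

/-- An order isomorphism is an isomorphism of cpo's. -/
def isoOfOrderIso (e : A.carrier ≃o B.carrier) : A ≅ B where
  hom := ⟨e, fun _ _ _ hx => e.isLUB_image'.2 hx⟩
  inv := ⟨e.symm, fun _ _ _ hx => e.symm.isLUB_image'.2 hx⟩
  hom_inv_id := hom_ext fun a => e.symm_apply_apply a
  inv_hom_id := hom_ext fun a => e.apply_symm_apply a

theorem mono_of_injective (f : A ⟶ B) (hf : Function.Injective f.toFun) : Mono f where
  right_cancellation g h e :=
    hom_ext fun a => hf (by rw [← comp_apply, ← comp_apply, e])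

/-! ### Subsets closed under joins of chains -/

/-- A set that contains the join of every chain contained in it. -/
def IsChainClosed (U : Set A.carrier) : Prop :=
  ∀ s ⊆ U, IsChain (· ≤ ·) s → ∀ x, IsLUB s x → x ∈ U

/-- The smallest set that contains `S` and the joins of all chains contained in it. -/
inductive chainClosure (S : Set A.carrier) : A.carrier → Prop
  | of (a : A.carrier) (ha : a ∈ S) : chainClosure S a
  | lub (s : Set A.carrier) (x : A.carrier) (hs : IsChain (· ≤ ·) s) (hx : IsLUB s x)
      (h : ∀ a ∈ s, chainClosure S a) : chainClosure S x

theorem isChainClosed_chainClosure (S : Set A.carrier) :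
    IsChainClosed {a | chainClosure S a} :=
  fun s h hs x hx => .lub s x hs hx fun _ ha => h ha

theorem isChain_image_val {U : Set A.carrier} {t : Set U} (ht : IsChain (· ≤ ·) t) :
    IsChain (· ≤ ·) (Subtype.val '' t) :=
  ht.image_of_map_rel _ _ Subtype.val fun _ _ h => h

/-- A subset closed under joins of chains, as a cpo with the induced order. -/
def sub (U : Set A.carrier) (hU : IsChainClosed U) : CPO.{u} where
  carrier := U
  exists_isLUB t ht := by
    obtain ⟨x, hx⟩ := A.exists_isLUB _ (isChain_image_val ht)
    have hxU : x ∈ U := hU _ (by rintro _ ⟨a, -, rfl⟩; exact a.2) (isChain_image_val ht) x hx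
    exact ⟨⟨x, hxU⟩, fun a ha => hx.1 ⟨a, ha, rfl⟩, fun b hb => hx.2 <| by
      rintro _ ⟨a, ha, rfl⟩
      exact hb ha⟩

section Sub

variable (U : Set A.carrier) (hU : IsChainClosed U)

/-- The inclusion of a subset closed under joins of chains. -/
def subι : sub U hU ⟶ A where
  toFun := Subtype.val
  map_isLUB t y ht hy := by
    obtain ⟨x, hx⟩ := A.exists_isLUB _ (isChain_image_val ht)
    have hxU : x ∈ U := hU _ (by rintro _ ⟨a, -, rfl⟩; exact a.2) (isChain_image_val ht) x hx
    have hx' : IsLUB t (⟨x, hxU⟩ : (sub U hU).carrier) :=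
      ⟨fun a ha => hx.1 ⟨a, ha, rfl⟩, fun b hb => hx.2 <| by
        rintro _ ⟨a, ha, rfl⟩
        exact hb ha⟩
    rw [hy.unique hx']
    exact hx

theorem mono_subι : Mono (subι U hU) :=
  mono_of_injective _ Subtype.val_injective

/-- A map whose values lie in a subset closed under joins of chains, with restricted codomain. -/
def subLift (f : B ⟶ A) (hf : ∀ b, f.toFun b ∈ U) : B ⟶ sub U hU where
  toFun b := ⟨f.toFun b, hf b⟩
  map_isLUB s x hs hx := by
    have h := f.map_isLUB s x hs hx
    refine ⟨?_, fun b hb => h.2 ?_⟩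
    · rintro _ ⟨a, ha, rfl⟩
      exact h.1 ⟨a, ha, rfl⟩
    · rintro _ ⟨a, ha, rfl⟩
      exact hb ⟨a, ha, rfl⟩

theorem subLift_comp_subι (f : B ⟶ A) (hf : ∀ b, f.toFun b ∈ U) :
    subLift U hU f hf ≫ subι U hU = f := rfl

end Sub

/-! ### Strong quotients -/

theorem chainClosure_range_of_strongEpi (e : A ⟶ B) [StrongEpi e] (b : B.carrier) :
    chainClosure (Set.range e.toFun) b := by
  let U : Set B.carrier := {b | chainClosure (Set.range e.toFun) b}
  have hU : IsChainClosed U := isChainClosed_chainClosure _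
  let e' : A ⟶ sub U hU := subLift U hU e fun a => .of _ ⟨a, rfl⟩
  have fac : e' ≫ subι U hU = e := subLift_comp_subι _ _ _ _
  have := mono_subι U hU
  have : IsIso (subι U hU) := ExtremalEpi.isIso (f := e) e' _ fac
  have h : (subι U hU).toFun ((inv (subι U hU)).toFun b) = b := by
    rw [← comp_apply, IsIso.inv_hom_id, id_apply]
  rw [← h]
  exact ((inv (subι U hU)).toFun b).2

theorem isLUB_of_chainClosure {S : Set A.carrier} {b : A.carrier} (hb : chainClosure S b) :
    IsLUB {a ∈ S | a ≤ b} b := by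
  induction hb with
  | of a ha => exact ⟨fun _ h => h.2, fun u hu => hu ⟨ha, le_rfl⟩⟩
  | lub s x hs hx _ ih =>
    refine ⟨fun _ h => h.2, fun u hu => hx.2 fun y hy => (ih y hy).2 fun a ha => ?_⟩
    exact hu ⟨ha.1, ha.2.trans (hx.1 hy)⟩

theorem le_iff_of_strongEpi (e : A ⟶ B) [StrongEpi e] {b c : B.carrier} :
    {a | e.toFun a ≤ b} ⊆ {a | e.toFun a ≤ c} ↔ b ≤ c := by
  refine ⟨fun h => (isLUB_of_chainClosure (chainClosure_range_of_strongEpi e b)).2 ?_,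
    fun h a (ha : _ ≤ b) => ha.trans h⟩
  rintro _ ⟨⟨a, rfl⟩, ha⟩
  exact h ha

theorem isWeaklyCowellpowered : IsWeaklyCowellpowered.{u} CPO.{u} := by
  intro A
  -- Strong quotients of `A` are represented by cpo's whose elements are subsets of `A`.
  let S : Type u := Σ (T : Set (Set A.carrier)) (h : PLift (∀ s : Set T, IsChain (· ≤ ·) s →
    ∃ x, IsLUB s x)), { q : A ⟶ (⟨T, h.down⟩ : CPO.{u}) // StrongEpi q }
  refine ⟨S, fun s => ⟨s.1, s.2.1.down⟩, fun s => s.2.2.1, fun s => s.2.2.2, fun B e he => ?_⟩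
  let ε : B.carrier ↪o Set A.carrier :=
    OrderEmbedding.ofMapLEIff (fun b => {a | e.toFun a ≤ b}) fun _ _ => le_iff_of_strongEpi e
  let σ : B.carrier ≃o Set.range ε := ε.orderIso
  have hT (s : Set (Set.range ε)) (hs : IsChain (· ≤ ·) s) : ∃ x, IsLUB s x := by
    obtain ⟨x, hx⟩ := B.exists_isLUB (σ.symm '' s)
      (hs.image_of_map_rel _ _ σ.symm fun _ _ h => σ.symm.monotone h)
    exact ⟨σ x, σ.symm.isLUB_image.1 hx⟩
  let i : B ≅ (⟨Set.range ε, hT⟩ : CPO.{u}) := isoOfOrderIso σ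
  refine ⟨⟨Set.range ε, ⟨hT⟩, e ≫ i.hom, inferInstance⟩, i.symm, ?_⟩
  simp

/-! ### Chain-open sets and colimits -/

/-- A set that contains the join of a chain exactly when it contains a member of the chain; in
other words, a map to the two-element chain. -/
def IsChainOpen (U : Set A.carrier) : Prop :=
  ∀ (s : Set A.carrier) (x : A.carrier), IsChain (· ≤ ·) s → IsLUB s x →
    (x ∈ U ↔ ∃ a ∈ s, a ∈ U)

theorem IsChainOpen.preimage {U : Set B.carrier} (hU : IsChainOpen U) (f : A ⟶ B) :
    IsChainOpen (f.toFun ⁻¹' U) := fun s x hs hx => by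
  rw [Set.mem_preimage, hU _ _ (f.isChain_image hs) (f.map_isLUB s x hs hx)]
  simp

theorem isChainOpen_setOf_not_le (a : A.carrier) : IsChainOpen {x | ¬ x ≤ a} :=
  fun s x _ hx => by
    simp only [Set.mem_ofPred_eq, isLUB_le_iff hx, mem_upperBounds, not_forall, exists_prop]

theorem IsChainOpen.mem_of_le {U : Set A.carrier} (hU : IsChainOpen U) {a b : A.carrier}
    (hab : a ≤ b) (ha : a ∈ U) : b ∈ U :=
  (hU {a, b} b (IsChain.pair hab) ⟨by simp [hab], fun _ h => h (by simp)⟩).2 ⟨a, by simp, ha⟩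

theorem le_of_forall_isChainOpen {a b : A.carrier}
    (h : ∀ U : Set A.carrier, IsChainOpen U → a ∈ U → b ∈ U) : a ≤ b := by
  by_contra hab
  exact h _ (isChainOpen_setOf_not_le b) hab le_rfl

/-- The power set of a type, ordered by inclusion. -/
def power (H : Type u) : CPO.{u} where
  carrier := Set H
  exists_isLUB s _ := ⟨sSup s, isLUB_sSup s⟩

instance (H : Type u) : Membership H (power H).carrier :=
  inferInstanceAs (Membership H (Set H))

theorem mem_iff_of_isLUB_power {H : Type u} {s : Set (power H).carrier} {x : (power H).carrier}
    (hx : IsLUB s x) (h : H) : h ∈ x ↔ ∃ y ∈ s, h ∈ y := by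
  have hs : x = (sSup s : Set H) := hx.unique (isLUB_sSup (α := Set H) s)
  subst hs
  exact Set.mem_sUnion (S := s)

section Colimits

variable {J : Type u} [SmallCategory J] (F : J ⥤ CPO.{u})

/-- The families of chain-open sets in the cpo's of a diagram that are compatible under preimage;
in other words, the cocones from the diagram to the two-element chain. -/
structure OpenFamily where
  toSet : ∀ j, Set (F.obj j).carrier
  isChainOpen : ∀ j, IsChainOpen (toSet j)
  preimage_eq : ∀ {j k : J} (f : j ⟶ k), (F.map f).toFun ⁻¹' toSet k = toSet j

variable {F} in
/-- The family of preimages of a chain-open set under a cocone. -/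
def OpenFamily.ofCocone (c : Cocone F) {U : Set c.pt.carrier} (hU : IsChainOpen U) :
    OpenFamily F where
  toSet j := (c.ι.app j).toFun ⁻¹' U
  isChainOpen j := hU.preimage _
  preimage_eq f := by
    rw [← c.w f]
    rfl

/-- An element of a cpo of a diagram, as the set of the families of chain-open sets that
contain it. -/
def toPower (j : J) : F.obj j ⟶ power (OpenFamily F) where
  toFun x := ({h | x ∈ h.toSet j} : Set (OpenFamily F))
  map_isLUB s x hs hx := by
    have hx' : ({h | x ∈ h.toSet j} : Set (OpenFamily F)) =
        sSup ((fun x => ({h | x ∈ h.toSet j} : Set (OpenFamily F))) '' s) := by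
      ext h
      simpa using h.isChainOpen j s x hs hx
    have h := isLUB_sSup ((fun x => ({h | x ∈ h.toSet j} : Set (OpenFamily F))) '' s)
    rw [← hx'] at h
    exact h

/-- The elements of the cpo's of a diagram, as sets of families of chain-open sets. -/
def generators : Set (power (OpenFamily F)).carrier := ⋃ j, Set.range (toPower F j).toFun

/-- The colimit of a diagram: the elements of the cpo's of the diagram generate it, under joins of
chains, inside the power set of the set of all families of chain-open sets. -/
def colimitObj : CPO.{u} := sub _ (isChainClosed_chainClosure (generators F))

/-- The colimit cocone of a diagram. -/
def colimitCocone : Cocone F where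
  pt := colimitObj F
  ι :=
    { app := fun j => subLift _ (isChainClosed_chainClosure (generators F)) (toPower F j)
        fun x => .of _ (Set.mem_iUnion.2 ⟨j, x, rfl⟩)
      naturality := fun j k f => hom_ext fun x => Subtype.ext <| Set.ext fun h => by
        change (F.map f).toFun x ∈ h.toSet k ↔ x ∈ h.toSet j
        rw [← h.preimage_eq f]
        rfl }

variable {F}

/-- An element of the colimit has an image in the point of any cocone, characterized by the
chain-open sets to which it belongs. -/
theorem exists_mem_iff_of_cocone (c : Cocone F) {q : (power (OpenFamily F)).carrier}
    (hq : chainClosure (generators F) q) :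
    ∃ y : c.pt.carrier, ∀ (U : Set c.pt.carrier) (hU : IsChainOpen U),
      y ∈ U ↔ OpenFamily.ofCocone c hU ∈ q := by
  induction hq with
  | of a ha =>
    obtain ⟨j, x, rfl⟩ := Set.mem_iUnion.1 ha
    exact ⟨(c.ι.app j).toFun x, fun U hU => Iff.rfl⟩
  | lub s x hs hx _ ih =>
    choose! y hy using ih
    have hmono {a b} (ha : a ∈ s) (hb : b ∈ s) (hab : a ≤ b) : y a ≤ y b :=
      le_of_forall_isChainOpen fun U hU hya => (hy b hb U hU).2 (hab ((hy a ha U hU).1 hya))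
    have hchain : IsChain (· ≤ ·) (y '' s) := by
      rintro _ ⟨a, ha, rfl⟩ _ ⟨b, hb, rfl⟩ -
      exact (hs.total ha hb).imp (hmono ha hb) (hmono hb ha)
    obtain ⟨z, hz⟩ := c.pt.exists_isLUB _ hchain
    refine ⟨z, fun U hU => ?_⟩
    rw [hU _ _ hchain hz, mem_iff_of_isLUB_power hx, Set.exists_mem_image]
    exact exists_congr fun a => and_congr_right fun ha => hy a ha U hU

/-- The map from the colimit to the point of a cocone. -/
noncomputable def colimitDesc (c : Cocone F) : colimitObj F ⟶ c.pt where
  toFun q := (exists_mem_iff_of_cocone c q.2).choose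
  map_isLUB s x hs hx := by
    have hspec (q : (colimitObj F).carrier) := (exists_mem_iff_of_cocone c q.2).choose_spec
    have hx' := (subι _ (isChainClosed_chainClosure (generators F))).map_isLUB s x hs hx
    refine ⟨?_, fun u hu => le_of_forall_isChainOpen fun U hU h => ?_⟩
    · rintro _ ⟨q, hq, rfl⟩
      refine le_of_forall_isChainOpen fun U hU h => ?_
      exact (hspec x U hU).2 (hx.1 hq ((hspec q U hU).1 h))
    · obtain ⟨_, ⟨q, hq, rfl⟩, h'⟩ := (mem_iff_of_isLUB_power hx' _).1 ((hspec x U hU).1 h)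
      exact hU.mem_of_le (hu ⟨q, hq, rfl⟩) ((hspec q U hU).2 h')

theorem colimitDesc_mem_iff (c : Cocone F) (q : (colimitObj F).carrier) {U : Set c.pt.carrier}
    (hU : IsChainOpen U) : (colimitDesc c).toFun q ∈ U ↔
      OpenFamily.ofCocone c hU ∈ q.1 :=
  (exists_mem_iff_of_cocone c q.2).choose_spec U hU

/-- Morphisms from a cpo generated by `S` under joins of chains are determined on `S`. -/
theorem eq_of_chainClosure {S : Set A.carrier}
    {f g : sub _ (isChainClosed_chainClosure S) ⟶ B}
    (h : ∀ a (ha : a ∈ S), f.toFun ⟨a, .of a ha⟩ = g.toFun ⟨a, .of a ha⟩) : f = g := by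
  suffices ∀ a (ha : chainClosure S a), f.toFun ⟨a, ha⟩ = g.toFun ⟨a, ha⟩ from
    hom_ext fun a => this a.1 a.2
  intro a ha
  induction ha with
  | of a ha => exact h a ha
  | lub s x hs hx hS ih =>
    let t : Set (sub _ (isChainClosed_chainClosure S)).carrier := {a | a.1 ∈ s}
    have ht : IsChain (· ≤ ·) t := fun a ha b hb hab =>
      hs ha hb fun e => hab (Subtype.ext e)
    have htx : IsLUB t (⟨x, .lub s x hs hx hS⟩ :
        (sub _ (isChainClosed_chainClosure S)).carrier) :=
      ⟨fun a ha => hx.1 ha, fun b hb => hx.2 fun a ha => hb (a := ⟨a, hS a ha⟩) ha⟩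
    have hfg : f.toFun '' t = g.toFun '' t := Set.image_congr fun a ha => ih a.1 ha
    have hf := f.map_isLUB t _ ht htx
    rw [hfg] at hf
    exact hf.unique (g.map_isLUB t _ ht htx)

variable (F) in
/-- The cocone of the cpo's of a diagram over the cpo that they generate is a colimit. -/
noncomputable def isColimitColimitCocone : IsColimit (colimitCocone F) where
  desc := colimitDesc
  fac c j := hom_ext fun x => by
    have h {U : Set c.pt.carrier} (hU : IsChainOpen U) :=
      colimitDesc_mem_iff c (((colimitCocone F).ι.app j).toFun x) hU
    exact le_antisymm (le_of_forall_isChainOpen fun U hU => (h hU).1)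
      (le_of_forall_isChainOpen fun U hU => (h hU).2)
  uniq c m hm := by
    refine eq_of_chainClosure fun a ha => ?_
    obtain ⟨j, x, rfl⟩ := Set.mem_iUnion.1 ha
    have hm' : m.toFun (((colimitCocone F).ι.app j).toFun x) = (c.ι.app j).toFun x := by
      rw [← hm j, comp_apply]
    refine hm'.trans ?_
    have h {U : Set c.pt.carrier} (hU : IsChainOpen U) :=
      colimitDesc_mem_iff c (((colimitCocone F).ι.app j).toFun x) hU
    exact le_antisymm (le_of_forall_isChainOpen fun U hU => (h hU).2)
      (le_of_forall_isChainOpen fun U hU => (h hU).1)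

end Colimits

instance hasColimits : HasColimits CPO.{u} where
  has_colimits_of_shape _ _ :=
    { has_colimit := fun F => ⟨⟨⟨_, isColimitColimitCocone F⟩⟩⟩ }

/-! ### Maps out of the three-element chain -/

/-- A pair `a ≤ b` in a cpo, as the map from the chain `0 < 1 < 2` that sends `1` to `a` and `2`
to `b`. -/
noncomputable def pairHom {a b : A.carrier} (hab : a ≤ b) : chain3.{u} ⟶ A where
  toFun n := ![⊥, a, b] n.down
  map_isLUB s x hs hx := by
    have hmono : Monotone (![⊥, a, b] : Fin 3 → A.carrier) := by
      rw [Fin.monotone_iff_le_succ]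
      intro i
      fin_cases i
      · exact bot_le
      · exact hab
    rcases s.eq_empty_or_nonempty with rfl | hne
    · have hx0 : x = ⟨0⟩ :=
        hx.unique ⟨fun _ h => h.elim, fun b _ => Fin.zero_le (ULift.down b)⟩
      subst hx0
      rw [Set.image_empty, isLUB_empty_iff]
      exact isBot_bot
    -- A nonempty chain in `3` contains its join.
    · have hfin : s.Finite := Set.Finite.of_injOn (f := ULift.down) (t := Set.univ)
        (fun _ _ => Set.mem_univ _) ULift.down_injective.injOn Set.finite_univ
      obtain ⟨y, hy, hmax⟩ := Set.exists_max_image s ULift.down hfin hne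
      have hxy : x = y := hx.unique ⟨hmax, fun _ h => h hy⟩
      subst hxy
      refine ⟨?_, fun u hu => hu ⟨x, hy, rfl⟩⟩
      rintro _ ⟨z, hz, rfl⟩
      exact hmono (hmax z hz)

theorem isStrongGenerator_singleton_chain3 :
    (ObjectProperty.singleton CPO.chain3.{u}).IsStrongGenerator := by
  rw [ObjectProperty.isStrongGenerator_iff]
  refine ⟨fun A B f g h => hom_ext fun a => ?_, fun A B i _ hi => ?_⟩
  · have := h chain3 (by simp) (pairHom (le_refl a))
    exact congrArg (fun k : chain3 ⟶ B => k.toFun ⟨1⟩) this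
  · have hinj : Function.Injective i.toFun := by
      intro a b hab
      have h : pairHom (le_refl a) = pairHom (le_refl b) := by
        rw [← cancel_mono i]
        refine hom_ext fun n => ?_
        obtain ⟨n⟩ := n
        fin_cases n
        · rfl
        · exact hab
        · exact hab
      exact congrArg (fun k : chain3 ⟶ A => k.toFun ⟨1⟩) h
    have hlift {b b' : B.carrier} (h : b ≤ b') :
        ∃ a a' : A.carrier, a ≤ a' ∧ i.toFun a = b ∧ i.toFun a' = b' := by
      obtain ⟨f, hf⟩ := hi chain3 (by simp) (pairHom h)
      have hf (n) : i.toFun (f.toFun n) = (pairHom h).toFun n := by rw [← hf]; rfl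
      exact ⟨f.toFun ⟨1⟩, f.toFun ⟨2⟩, f.monotone (show (1 : Fin 3) ≤ 2 by decide), hf _, hf _⟩
    have hle {a a' : A.carrier} : i.toFun a ≤ i.toFun a' ↔ a ≤ a' := by
      refine ⟨fun h => ?_, fun h => i.monotone h⟩
      obtain ⟨c, c', hc, h1, h2⟩ := hlift h
      rwa [hinj h1, hinj h2] at hc
    have hsurj : Function.Surjective i.toFun := fun b => by
      obtain ⟨a, -, -, h, -⟩ := hlift (le_refl b)
      exact ⟨a, h⟩
    let e : A.carrier ≃o B.carrier :=
      RelIso.ofSurjective (OrderEmbedding.ofMapLEIff i.toFun fun _ _ => hle) hsurj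
    exact inferInstanceAs (IsIso (isoOfOrderIso e).hom)

/-! ### Coproducts -/

section Coproducts

variable {ι : Type u} (X : ι → CPO.{u})

open Classical in
/-- The retraction of a coproduct onto a summand that sends all other summands to the least
element. -/
noncomputable def proj (i : ι) : ∐ X ⟶ X i :=
  Sigma.desc fun j => if h : j = i then eqToHom (congrArg X h) else botHom _ _

theorem ι_proj (i : ι) : Sigma.ι X i ≫ proj X i = 𝟙 (X i) := by
  simp [proj]

theorem proj_ι_of_ne {i j : ι} (h : j ≠ i) (x : (X j).carrier) :
    (proj X i).toFun ((Sigma.ι X j).toFun x) = ⊥ := by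
  rw [← comp_apply, proj, Sigma.ι_desc, dif_neg h]
  rfl

theorem proj_ι_self (i : ι) (x : (X i).carrier) :
    (proj X i).toFun ((Sigma.ι X i).toFun x) = x := by
  rw [← comp_apply, ι_proj, id_apply]

variable {X}

/-- A subset of a coproduct that contains all summands and is closed under joins of chains is the
whole coproduct. -/
theorem mem_of_isChainClosed {U : Set (∐ X).carrier} (hU : IsChainClosed U)
    (h : ∀ i x, (Sigma.ι X i).toFun x ∈ U) (z : (∐ X).carrier) : z ∈ U := by
  let d : ∐ X ⟶ sub U hU := Sigma.desc fun i => subLift U hU (Sigma.ι X i) (h i)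
  have hd : d ≫ subι U hU = 𝟙 _ := Sigma.hom_ext _ _ fun i => by
    rw [← Category.assoc, Sigma.ι_desc, subLift_comp_subι, Category.comp_id]
  have hz : (subι U hU).toFun (d.toFun z) = z := by rw [← comp_apply, hd, id_apply]
  rw [← hz]
  exact (d.toFun z).2

/-- If a nontrivial element of one summand lies below an element of another, the two summands are
the same: the projection to the first would send the larger element to the least one. -/
theorem eq_of_ι_le_ι {i j : ι} {x : (X i).carrier} {y : (X j).carrier}
    (h : (Sigma.ι X i).toFun x ≤ (Sigma.ι X j).toFun y) (hx : x ≠ ⊥) : i = j := by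
  by_contra hij
  have h' := (proj X i).monotone h
  rw [proj_ι_self, proj_ι_of_ne X (Ne.symm hij)] at h'
  exact hx (le_bot_iff.1 h')

theorem eq_bot_or_exists_eq_ι (z : (∐ X).carrier) :
    z = ⊥ ∨ ∃ i, ∃ x ≠ ⊥, z = (Sigma.ι X i).toFun x := by
  refine mem_of_isChainClosed
    (U := {z | z = ⊥ ∨ ∃ i, ∃ x ≠ ⊥, z = (Sigma.ι X i).toFun x}) ?_ ?_ z
  · intro s hsU hs z hz
    by_cases hbot : ∀ a ∈ s, a = ⊥
    · exact Or.inl (le_bot_iff.1 (hz.2 fun a ha => (hbot a ha).le))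
    push Not at hbot
    obtain ⟨a, ha, ha0⟩ := hbot
    obtain ⟨i, x, hx, rfl⟩ := (hsU ha).resolve_left ha0
    -- The chain lies in the summand `i`, a retract of the coproduct, so its join lies there too.
    have hret : ∀ b ∈ s, (Sigma.ι X i).toFun ((proj X i).toFun b) = b := by
      intro b hb
      rcases hsU hb with rfl | ⟨j, y, hy, rfl⟩
      · rw [Hom.map_bot, Hom.map_bot]
      · obtain rfl : i = j := (hs.total ha hb).elim (fun h => eq_of_ι_le_ι h hx)
          fun h => (eq_of_ι_le_ι h hy).symm
        rw [proj_ι_self]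
    have hlub := (proj X i ≫ Sigma.ι X i).map_isLUB s z hs hz
    have him : (proj X i ≫ Sigma.ι X i).toFun '' s = s :=
      (Set.image_congr hret).trans (Set.image_id' s)
    rw [him] at hlub
    refine Or.inr ⟨i, (proj X i).toFun z, fun h0 => hx (le_bot_iff.1 ?_), hz.unique hlub⟩
    rw [← h0, ← proj_ι_self X i x]
    exact (proj X i).monotone (hz.1 ha)
  · intro i x
    by_cases hx : x = ⊥
    · exact Or.inl (by rw [hx, Hom.map_bot])
    · exact Or.inr ⟨i, x, hx, rfl⟩

/-- A summand of a coproduct is a lower set. -/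
theorem ι_proj_of_le_ι {i : ι} {x : (X i).carrier} {z : (∐ X).carrier}
    (h : z ≤ (Sigma.ι X i).toFun x) : (Sigma.ι X i).toFun ((proj X i).toFun z) = z := by
  rcases eq_bot_or_exists_eq_ι z with rfl | ⟨j, y, hy, rfl⟩
  · rw [Hom.map_bot, Hom.map_bot]
  · obtain rfl := eq_of_ι_le_ι h hy
    rw [proj_ι_self]

/-- A map from a cpo with a greatest element to a coproduct is constantly the least element or
factors through a summand. -/
theorem eq_botHom_or_exists_factor {t : A.carrier} (ht : IsTop t) (f : A ⟶ ∐ X) :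
    f = botHom _ _ ∨ ∃ i, (f ≫ proj X i) ≫ Sigma.ι X i = f := by
  rcases eq_bot_or_exists_eq_ι (f.toFun t) with h | ⟨i, x, -, h⟩
  · exact Or.inl (hom_ext fun a => le_bot_iff.1 (h ▸ f.monotone (ht a)))
  · exact Or.inr ⟨i, hom_ext fun a => ι_proj_of_le_ι (h ▸ f.monotone (ht a))⟩

open Classical in
/-- A subcoproduct is a retract of the coproduct: the remaining summands are sent to the least
element. -/
theorem mono_subcoproductsCocone_app {κ : Cardinal.{u}} (J : {J : Set ι // HasCardinalLT J κ}) :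
    Mono ((subcoproductsCocone κ X).ι.app J) := by
  let r : ∐ X ⟶ (subcoproducts κ X).obj J :=
    Sigma.desc fun i => if hi : i ∈ J.1 then subcoproductsι J hi else botHom _ _
  have hr : (subcoproductsCocone κ X).ι.app J ≫ r = 𝟙 _ :=
    subcoproducts_hom_ext fun i hi => by
      have h : Sigma.ι X i ≫ r = subcoproductsι J hi := (Sigma.ι_desc _ _).trans (dif_pos hi)
      rw [← subcoproductsι_app J hi] at h
      exact h.trans (Category.comp_id _).symm
  exact mono_of_mono_fac hr

end Coproducts

theorem isNearlyPresentable_chain3 :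
    IsNearlyPresentable (ℵ₀ : Cardinal.{u}) CPO.chain3.{u} := by
  intro ι X
  have : IsDirectedOrder {J : Set ι // HasCardinalLT J (ℵ₀ : Cardinal.{u})} :=
    ⟨fun J K => ⟨⟨J.1 ∪ K.1, hasCardinalLT_union le_rfl J.2 K.2⟩,
      Set.subset_union_left, Set.subset_union_right⟩⟩
  have hempty : HasCardinalLT (∅ : Set ι) (ℵ₀ : Cardinal.{u}) := by
    rw [hasCardinalLT_aleph0_iff]
    infer_instance
  have : Nonempty {J : Set ι // HasCardinalLT J (ℵ₀ : Cardinal.{u})} := ⟨⟨∅, hempty⟩⟩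
  obtain ⟨hc⟩ := nonempty_isColimit_subcoproductsCocone (ℵ₀ : Cardinal.{u}) X
  refine preservesColimit_of_preserves_colimit_cocone hc
    (Types.FilteredColimit.isColimitOf' _ _ (fun f => ?_) fun J f g h => ⟨J, 𝟙 J, ?_⟩)
  · have ht : IsTop (⟨2⟩ : chain3.{u}.carrier) := fun n => Fin.le_last (ULift.down n)
    rcases eq_botHom_or_exists_factor (X := X) ht f with h | ⟨i, h⟩
    · refine ⟨⟨∅, hempty⟩, botHom _ _, h.trans (hom_ext fun a => ?_)⟩
      exact (Hom.map_bot _).symm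
    · have hi : HasCardinalLT ({i} : Set ι) (ℵ₀ : Cardinal.{u}) := by
        rw [hasCardinalLT_aleph0_iff]
        infer_instance
      refine ⟨⟨{i}, hi⟩, (f ≫ proj X i) ≫ subcoproductsι ⟨{i}, hi⟩ rfl, ?_⟩
      rw [← subcoproductsι_app ⟨{i}, hi⟩ rfl] at h
      exact h.symm
  · have := mono_subcoproductsCocone_app (X := X) J
    have hfg : f = g := (cancel_mono ((subcoproductsCocone _ X).ι.app J)).1 h
    rw [hfg]

end CPO

theorem mainTheorem6 :
    IsNearlyLocallyPresentable CPO.{u} (ℵ₀ : Cardinal.{u}) ∧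
    ∃ _ : HasColimits CPO.{u},
      IsWeaklyCowellpowered.{u} CPO.{u} ∧
      IsNearlyPresentable (ℵ₀ : Cardinal.{u}) CPO.chain3.{u} ∧
      (ObjectProperty.singleton CPO.chain3.{u}).IsStrongGenerator := by
  refine ⟨⟨CPO.isWeaklyCowellpowered, ObjectProperty.singleton CPO.chain3, inferInstance,
      CPO.isStrongGenerator_singleton_chain3, ?_⟩,
    inferInstance, CPO.isWeaklyCowellpowered, CPO.isNearlyPresentable_chain3,
    CPO.isStrongGenerator_singleton_chain3⟩
  rintro _ ⟨⟩
  exact CPO.isNearlyPresentable_chain3
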